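/- For $n\ge 0$ let $\ell_T(w)$ denote the least number $k$ such that the permutation $w\in\mathcal S_n$ is a product of $k$ transpositions, and order $\mathcal S_n$ by the absolute order: $u\preceq v$ if and only if $\ell_T(u)+\ell_T(u^{-1}v)=\ell_T(v)$. Let $\bar P_n=(\mathcal S_n\smallsetminus\{e\},\preceq)$, where $e$ is the identity, and let $\Delta(\bar P_n)$ be its order complex, the abstract simplicial complex whose faces are the chains of $\bar P_n$ (including the empty chain). Let $\tilde\chi(\Delta)=\sum_{F\in\Delta}(-1)^{\dim F}=\sum_{F\in\Delta}(-1)^{\#F-1}$ denote the reduced Euler characteristic of a finite simplicial complex $\Delta$, the sum being over all faces of $\Delta$, including the empty face. **Theorem 1.2.** As formal power series in $t$ with rational coefficients, $$\sum_{n\ge 1}(-1)^n\,\tilde\chi(\Delta(\bar P_n))\,\frac{t^n}{n!}\;=\;1-C(t)\exp\{-2t\,C(t)\},$$ where $C(t)=\sum_{m\ge 0}\frac{1}{m+1}\binom{2m}{m}t^m$ is the ordinary generating function of the Catalan numbers, for which $2t\,C(t)=1-\sqrt{1-4t}$, that is, $C(t)=\frac{1}{2t}\bigl(1-\sqrt{1-4t}\bigr)$.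 Here $\sqrt{1-4t}=\sum_{k\ge 0}\binom{1/2}{k}(-4t)^k$. -/

import Mathlib

open PowerSeries

/-- `reflectionLength T w` is the smallest `k` such that `w` is a product of `k` elements of `T`
(for a generating set `T` of reflections of the group `W`). -/
noncomputable def reflectionLength {W : Type*} [Group W] (T : Set W) (w : W) : ℕ :=
  sInf {k : ℕ | ∃ l : List W, l.length = k ∧ (∀ t ∈ l, t ∈ T) ∧ l.prod = w}

/-- The underlying set of the symmetric group on `n` letters, to be ordered by the absolute
order. -/
def AbsPerm (n : ℕ) : Type := Equiv.Perm (Fin n)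

namespace AbsPerm

instance (n : ℕ) : Group (AbsPerm n) := inferInstanceAs (Group (Equiv.Perm (Fin n)))
instance (n : ℕ) : Fintype (AbsPerm n) := inferInstanceAs (Fintype (Equiv.Perm (Fin n)))
instance (n : ℕ) : DecidableEq (AbsPerm n) := inferInstanceAs (DecidableEq (Equiv.Perm (Fin n)))

/-- The reflections of the symmetric group: the transpositions. -/
def transpositions (n : ℕ) : Set (AbsPerm n) := {t | Equiv.Perm.IsSwap (α := Fin n) t}

/-- The absolute length `ℓ_T` on the symmetric group. -/
noncomputable def len {n : ℕ} (w : AbsPerm n) : ℕ := reflectionLength (transpositions n) w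

theorem exists_list {n : ℕ} (w : AbsPerm n) :
    ∃ l : List (AbsPerm n), l.length = len w ∧ (∀ t ∈ l, t ∈ transpositions n) ∧ l.prod = w := by
  have hne : {k : ℕ | ∃ l : List (AbsPerm n), l.length = k ∧
      (∀ t ∈ l, t ∈ transpositions n) ∧ l.prod = w}.Nonempty := by
    obtain ⟨l, hl⟩ := (Equiv.Perm.truncSwapFactors (α := Fin n) w).out
    exact ⟨_, l, rfl, hl.2, hl.1⟩
  exact Nat.sInf_mem hne

theorem len_le {n : ℕ} (l : List (AbsPerm n)) (hl : ∀ t ∈ l, t ∈ transpositions n) :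
    len l.prod ≤ l.length :=
  Nat.sInf_le ⟨l, rfl, hl, rfl⟩

theorem len_one (n : ℕ) : len (1 : AbsPerm n) = 0 :=
  Nat.le_zero.mp (len_le ([] : List (AbsPerm n)) (by simp))

theorem eq_one_of_len {n : ℕ} {w : AbsPerm n} (h : len w = 0) : w = 1 := by
  obtain ⟨l, h1, -, h3⟩ := exists_list w
  rw [h, List.length_eq_zero_iff] at h1
  rw [← h3, h1, List.prod_nil]

theorem len_mul_le {n : ℕ} (u v : AbsPerm n) : len (u * v) ≤ len u + len v := by
  obtain ⟨l, h1, h2, h3⟩ := exists_list u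
  obtain ⟨m, k1, k2, k3⟩ := exists_list v
  rw [← h1, ← k1, ← List.length_append]
  conv_lhs => rw [← h3, ← k3, ← List.prod_append]
  refine len_le _ fun t ht => ?_
  rcases List.mem_append.mp ht with h | h
  · exact h2 t h
  · exact k2 t h

/-- The absolute order: `u ≤ v` if and only if `ℓ_T(u) + ℓ_T(u⁻¹ v) = ℓ_T(v)`. -/
noncomputable instance (n : ℕ) : PartialOrder (AbsPerm n) where
  le u v := len u + len (u⁻¹ * v) = len v
  le_refl u := by simp [len_one]
  le_trans u v w huv hvw := by
    have h1 : u⁻¹ * w = (u⁻¹ * v) * (v⁻¹ * w) := by group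
    have h2 := len_mul_le (u⁻¹ * v) (v⁻¹ * w)
    have h3 := len_mul_le u (u⁻¹ * w)
    rw [mul_inv_cancel_left] at h3
    rw [← h1] at h2
    change len u + len (u⁻¹ * w) = len w
    omega
  le_antisymm u v huv hvu := by
    have h : len (u⁻¹ * v) = 0 := by omega
    exact inv_mul_eq_one.mp (eq_one_of_len h)

/-- The proper part of the absolute order on the symmetric group: all permutations other than the
identity, with the induced order. -/
abbrev ProperPart (n : ℕ) : Type := {w : AbsPerm n // w ≠ 1}

end AbsPerm

/-- The order complex of a poset `P`: the vertices are the elements of `P`, the (nonempty) faces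
are the nonempty finite chains of `P`. -/
def orderComplex (P : Type*) [PartialOrder P] : AbstractSimplicialComplex P where
  faces := {s | s.Nonempty ∧ IsChain (· ≤ ·) (s : Set P)}
  isRelLowerSet_faces := fun _ hs =>
    ⟨hs.1, fun _ hts ht => ⟨ht, hs.2.mono (Finset.coe_subset.mpr hts)⟩⟩
  singleton_mem v := ⟨Finset.singleton_nonempty v, by simp⟩

open Classical in
/-- The reduced Euler characteristic `∑_F (-1) ^ dim F` of a finite simplicial complex, where `F`
runs over all faces including the empty one. Mathlib's faces are the nonempty ones; the empty face
has dimension `-1` and contributes the summand `-1`. A face with `k` vertices has dimension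
`k - 1`, and `(-1) ^ (k - 1) = (-1) ^ (k + 1)`. -/
noncomputable def reducedEulerChar {V : Type*} [Fintype V] (K : AbstractSimplicialComplex V) : ℤ :=
  -1 + ∑ F : Finset V with F ∈ K.faces, (-1 : ℤ) ^ (F.card + 1)

/-- The ordinary generating function `C(t)` of the Catalan numbers, with rational coefficients. -/
noncomputable def catalanGF : ℚ⟦X⟧ := PowerSeries.mk fun m => (catalan m : ℚ)

/-- The power series `√(1 - 4t) = (1 - 4t) ^ (1 / 2)`, as a binomial series. -/
noncomputable def sqrtOneSubFour : ℚ⟦X⟧ :=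
  PowerSeries.rescale (-4 : ℚ) (PowerSeries.binomialSeries ℚ (1 / 2 : ℚ))

theorem sqrtOneSubFour_sq : sqrtOneSubFour ^ 2 = 1 - 4 * (X : ℚ⟦X⟧) := by
  have h : PowerSeries.binomialSeries ℚ (1 / 2 : ℚ) ^ 2 = 1 + X := by
    rw [sq, ← PowerSeries.binomialSeries_add]
    have := PowerSeries.binomialSeries_nat (R := ℚ) (A := ℚ) 1
    norm_num at this ⊢
    exact this
  have h4 : (PowerSeries.C (-4 : ℚ)) = (-4 : ℚ⟦X⟧) := by
    rw [map_neg, map_ofNat]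
  rw [sqrtOneSubFour, ← map_pow, h, map_add, map_one, PowerSeries.rescale_X, h4]
  ring

/-!
The reduced Euler characteristic of the order complex of `S_n` without the identity is minus the
sum over `w ∈ S_n` of the Möbius function `μ(e, w)` of the absolute order. This Möbius function is
the product over the cycles of `w` of the signed Catalan numbers `(-1)^(k-1) catalan (k-1)`, where
`k` is the length of the cycle, so the exponential formula gives the generating function.

The Möbius function is identified without describing intervals as lattices of noncrossing
partitions. The absolute length is `∑ (k - 1)` over the cycles (`AbsPerm.len_eq_cycleRank`),
because multiplying by `swap i j` splits or joins cycles: for lists,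
`(l ++ l').formPerm` is `swap (head of l) (head of l')` times `l.formPerm * l'.formPerm`.
Let `w ≠ 1` move the point `n`. Every `u` is uniquely `u' * swap n i` with `u'` fixing `n`, and for
fixed `u'` the permutations `u⁻¹ * w = swap n i * (u'⁻¹ * w)` with `u` below `w` are obtained by
cutting the cycle of `n` in `u'⁻¹ * w` in all possible ways. The weights of the results cancel by
the Catalan recurrence (`Equiv.Perm.sum_cycleWeight_swap_mul_eq_zero`), which is the defining
recursion of the Möbius function (`Equiv.Perm.sum_cycleWeight_interval_eq_zero`).
The passage from this recursion to chains is `sum_chains_subset_lowerSet`, proved by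
removing maximal elements one at a time.

For the count, removing a marked point from its cycle gives a recursion for the total weight of the
permutations supported on a finite set, the cycle of the marked point having a weight of its own
(`Equiv.Perm.sum_cycleWeight_and_sum_markedWeight`). It says that the exponential generating
function `E` satisfies `E'(t) = C(-t) E(t)`. On the other side, `C = 1 + t C ^ 2` gives
`G' = -C G` for `G = C exp(-2tC)` (`derivative_catalanExp`), so `E(t) = G(-t)`.
-/

/-! ### Splitting and joining cycles; the absolute length -/

namespace Equiv.Perm

variable {α : Type*} [DecidableEq α]

/-- Multiplying by the transposition of their first elements joins two cycles. -/
theorem formPerm_append_cons_eq_swap_mul (i j : α) (a b : List α) (hj : j ∉ i :: a) :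
    (i :: a ++ j :: b).formPerm = swap i j * ((i :: a).formPerm * (j :: b).formPerm) := by
  induction a generalizing i with
  | nil => simp
  | cons k a ih =>
    have hjk : j ∉ k :: a := fun h => hj (List.mem_cons_of_mem _ h)
    have hji : j ≠ i := fun h => hj (h ▸ List.mem_cons_self)
    have hjk' : j ≠ k := fun h => hjk (h ▸ List.mem_cons_self)
    have hs : swap i k * swap k j = swap i j * swap i k := by
      rw [mul_swap_eq_swap_mul, swap_apply_right, swap_apply_of_ne_of_ne hji hjk']
    have := ih k hjk
    simp only [List.cons_append, List.formPerm_cons_cons] at this ⊢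
    rw [this, ← mul_assoc, hs]
    simp only [mul_assoc]

theorem formPerm_mul_apply_of_notMem (l : List α) (r : Perm α) (hr : ∀ y ∈ l, r y = y) {x : α}
    (hx : x ∉ l) : (l.formPerm * r) x = r x := by
  rw [mul_apply]
  refine List.formPerm_apply_of_notMem fun h => hx ?_
  rwa [r.injective (hr _ h)] at h

theorem formPerm_mul_apply_of_mem (l : List α) (r : Perm α) (hr : ∀ y ∈ l, r y = y) {x : α}
    (hx : x ∈ l) : (l.formPerm * r) x = l.formPerm x := by
  rw [mul_apply, hr x hx]

theorem disjoint_formPerm (l : List α) (r : Perm α) (hr : ∀ y ∈ l, r y = y) :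
    Disjoint l.formPerm r := by
  intro y
  by_cases hy : y ∈ l
  · exact Or.inr (hr y hy)
  · exact Or.inl (List.formPerm_apply_of_notMem hy)

theorem formPerm_mul_formPerm_mul_fixed {i j : α} {a b : List α} {r : Perm α}
    (hl : (i :: a ++ j :: b).Nodup) (hr : ∀ y ∈ i :: a ++ j :: b, r y = y) :
    ∀ y ∈ i :: a, ((j :: b).formPerm * r) y = y := by
  intro y hy
  have hd := (List.nodup_append.mp hl).2.2
  have hyb : y ∉ j :: b := fun h => hd y hy y h rfl
  rw [formPerm_mul_apply_of_notMem _ _ (fun z hz => hr z (List.mem_append_right _ hz)) hyb]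
  exact hr y (List.mem_append_left _ hy)

theorem swap_mul_formPerm_append {i j : α} {a b : List α} {r : Perm α}
    (hl : (i :: a ++ j :: b).Nodup) :
    swap i j * ((i :: a ++ j :: b).formPerm * r) =
      (i :: a).formPerm * ((j :: b).formPerm * r) := by
  have hj : j ∉ i :: a := fun h =>
    (List.nodup_append.mp hl).2.2 j h j List.mem_cons_self rfl
  rw [formPerm_append_cons_eq_swap_mul _ _ _ _ hj]
  simp only [← mul_assoc, swap_mul_self, one_mul]

variable [Fintype α]

/-- Every permutation factors as the cycle through `i`, written as a list starting with `i`, times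
a permutation fixing that cycle pointwise. The list is `[i]` when `i` is a fixed point. -/
theorem exists_eq_formPerm_mul (w : Perm α) (i : α) :
    ∃ (a : List α) (r : Perm α), (i :: a).Nodup ∧ (∀ y ∈ i :: a, r y = y) ∧
      w = (i :: a).formPerm * r := by
  by_cases hi : w i = i
  · exact ⟨[], w, by simp, by simpa using hi, by simp⟩
  have hmem : i ∈ w.support := by simpa using hi
  have hl : ∃ a, w.toList i = i :: a := by
    have h0 := length_toList_pos_of_mem_support w i hmem
    have h1 := toList_getElem_zero w i hmem
    cases h : w.toList i with
    | nil => simp [h] at h0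
    | cons b a => simp [h] at h1; exact ⟨a, by rw [h1]⟩
  obtain ⟨a, ha⟩ := hl
  refine ⟨a, (w.cycleOf i)⁻¹ * w, ha ▸ nodup_toList w i, ?_, ?_⟩
  · intro y hy
    rw [← ha, mem_toList_iff] at hy
    rw [mul_apply, ← hy.1.cycleOf_apply, ← mul_apply, inv_mul_cancel, one_apply]
  · rw [← ha, formPerm_toList, mul_inv_cancel_left]

theorem cycleType_formPerm_mul (i : α) (a : List α) (r : Perm α) (hl : (i :: a).Nodup)
    (hr : ∀ y ∈ i :: a, r y = y) :
    ((i :: a).formPerm * r).cycleType = (if a = [] then 0 else {a.length + 1}) + r.cycleType := by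
  rw [(disjoint_formPerm _ _ hr).cycleType_mul]
  congr 1
  cases a with
  | nil => simp
  | cons j a =>
    have h := List.isCycle_formPerm hl (by simp)
    rw [h.cycleType, List.support_formPerm_of_nodup _ hl (by simp), List.toFinset_card_of_nodup hl]
    simp

/-- The product of `φ k` over the nontrivial cycles of `w`, where `k` is the length of the cycle.
When `φ 1 = 1`, the fixed points may be included as cycles of length one. -/
def cycleWeight {M : Type*} [CommMonoid M] (φ : ℕ → M) (w : Perm α) : M :=
  (w.cycleType.map φ).prod

/-- The sum of `k - 1` over the cycles of `w`, where `k` is the length of the cycle. -/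
def cycleRank (w : Perm α) : ℕ := (w.cycleType.map (· - 1)).sum

theorem cycleWeight_formPerm_mul {M : Type*} [CommMonoid M] (φ : ℕ → M) (h1 : φ 1 = 1)
    (i : α) (a : List α) (r : Perm α) (hl : (i :: a).Nodup) (hr : ∀ y ∈ i :: a, r y = y) :
    cycleWeight φ ((i :: a).formPerm * r) = φ (a.length + 1) * cycleWeight φ r := by
  rw [cycleWeight, cycleType_formPerm_mul i a r hl hr]
  split_ifs with h
  · simp [h, h1, cycleWeight]
  · simp [cycleWeight]

theorem cycleRank_formPerm_mul (i : α) (a : List α) (r : Perm α) (hl : (i :: a).Nodup)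
    (hr : ∀ y ∈ i :: a, r y = y) :
    cycleRank ((i :: a).formPerm * r) = a.length + cycleRank r := by
  rw [cycleRank, cycleType_formPerm_mul i a r hl hr]
  split_ifs with h
  · simp [h, cycleRank]
  · simp [cycleRank]

theorem cycleRank_inv (w : Perm α) : cycleRank w⁻¹ = cycleRank w := by
  rw [cycleRank, cycleRank, cycleType_inv]

theorem cycleWeight_swap_mul_split {M : Type*} [CommMonoid M] (φ : ℕ → M) (h1 : φ 1 = 1)
    {i j : α} {a b : List α} {r : Perm α}
    (hl : (i :: a ++ j :: b).Nodup) (hr : ∀ y ∈ i :: a ++ j :: b, r y = y) :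
    cycleWeight φ (swap i j * ((i :: a ++ j :: b).formPerm * r)) =
      φ (a.length + 1) * (φ (b.length + 1) * cycleWeight φ r) := by
  rw [swap_mul_formPerm_append hl, cycleWeight_formPerm_mul φ h1 i a _ (List.nodup_append.mp hl).1
    (formPerm_mul_formPerm_mul_fixed hl hr), cycleWeight_formPerm_mul φ h1 j b _
    (List.nodup_append.mp hl).2.1 (fun z hz => hr z (List.mem_append_right _ hz))]

theorem cycleRank_swap_mul_split {i j : α} {a b : List α} {r : Perm α}
    (hl : (i :: a ++ j :: b).Nodup) (hr : ∀ y ∈ i :: a ++ j :: b, r y = y) :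
    cycleRank (swap i j * ((i :: a ++ j :: b).formPerm * r)) + 1 =
      cycleRank ((i :: a ++ j :: b).formPerm * r) := by
  rw [swap_mul_formPerm_append hl, cycleRank_formPerm_mul i a _ (List.nodup_append.mp hl).1
    (formPerm_mul_formPerm_mul_fixed hl hr), cycleRank_formPerm_mul j b _
    (List.nodup_append.mp hl).2.1 (fun z hz => hr z (List.mem_append_right _ hz)),
    List.cons_append, cycleRank_formPerm_mul i (a ++ j :: b) r hl hr]
  simp
  omega

/-- Multiplying by `swap i j` with `j` in the cycle of `i` splits that cycle. -/
theorem cycleRank_swap_mul_of_mem {i j : α} {a : List α} {r : Perm α} (hl : (i :: a).Nodup)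
    (hr : ∀ y ∈ i :: a, r y = y) (hj : j ∈ a) :
    cycleRank (swap i j * ((i :: a).formPerm * r)) + 1 = cycleRank ((i :: a).formPerm * r) := by
  obtain ⟨s, t, rfl⟩ := List.append_of_mem hj
  exact cycleRank_swap_mul_split hl hr

/-- Multiplying by `swap i j` with `j` outside the cycle of `i` joins the cycles of `i` and `j`. -/
theorem cycleRank_swap_mul_of_notMem {i j : α} {a : List α} {r : Perm α} (hl : (i :: a).Nodup)
    (hr : ∀ y ∈ i :: a, r y = y) (hj : j ∉ i :: a) :
    cycleRank (swap i j * ((i :: a).formPerm * r)) = cycleRank ((i :: a).formPerm * r) + 1 := by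
  obtain ⟨b, s, hb, hs, rfl⟩ := exists_eq_formPerm_mul r j
  -- No element of the cycle `j :: b` is fixed, so it cannot meet the fixed points `i :: a`.
  have hd : ∀ y ∈ i :: a, y ∉ j :: b := by
    intro y hy hyb
    have h := hr y hy
    rw [formPerm_mul_apply_of_mem _ _ hs hyb, List.formPerm_apply_mem_eq_self_iff _ hb y hyb] at h
    have : b = [] := by simpa using h
    subst this
    simp only [List.mem_singleton] at hyb
    exact hj (hyb ▸ hy)
  have hl' : (i :: a ++ j :: b).Nodup :=
    List.nodup_append.mpr ⟨hl, hb, fun y hy z hz h => hd y hy (h ▸ hz)⟩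
  have hs' : ∀ y ∈ i :: a ++ j :: b, s y = y := by
    intro y hy
    rcases List.mem_append.mp hy with h | h
    · rw [← formPerm_mul_apply_of_notMem _ _ hs (hd y h), hr y h]
    · exact hs y h
  have h := cycleRank_swap_mul_split hl' hs'
  have e := swap_mul_formPerm_append (r := s) hl'
  rw [e] at h
  rw [← e, ← mul_assoc, swap_mul_self, one_mul, e, h]

theorem cycleRank_swap_mul_le (i j : α) (w : Perm α) :
    cycleRank (swap i j * w) ≤ cycleRank w + 1 := by
  by_cases hij : i = j
  · subst hij
    rw [swap_self, ← one_def, one_mul]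
    exact Nat.le_succ _
  obtain ⟨a, r, hl, hr, rfl⟩ := exists_eq_formPerm_mul w i
  by_cases hj : j ∈ i :: a
  · have hja : j ∈ a := by simpa [Ne.symm hij] using hj
    have := cycleRank_swap_mul_of_mem hl hr hja
    omega
  · exact (cycleRank_swap_mul_of_notMem hl hr hj).le

theorem cycleRank_list_prod_le (l : List (Perm α)) (hl : ∀ t ∈ l, t.IsSwap) :
    cycleRank l.prod ≤ l.length := by
  induction l with
  | nil => simp [cycleRank]
  | cons t l ih =>
    obtain ⟨x, y, -, rfl⟩ := hl t List.mem_cons_self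
    rw [List.prod_cons, List.length_cons]
    exact (cycleRank_swap_mul_le x y _).trans
      (Nat.succ_le_succ (ih fun t ht => hl t (List.mem_cons_of_mem _ ht)))

theorem exists_list_length_eq_cycleRank (w : Perm α) :
    ∃ l : List (Perm α), l.length = cycleRank w ∧ (∀ t ∈ l, t.IsSwap) ∧ l.prod = w := by
  induction h : cycleRank w using Nat.strong_induction_on generalizing w with
  | _ k ih =>
    by_cases hw : w = 1
    · subst hw
      exact ⟨[], by simpa [cycleRank] using h, by simp, by simp⟩
    obtain ⟨i, hi⟩ : ∃ i, w i ≠ i := by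
      by_contra! hc
      exact hw (Equiv.ext hc)
    obtain ⟨a, r, hl, hr, e⟩ := exists_eq_formPerm_mul w i
    obtain ⟨j, b, rfl⟩ : ∃ j b, a = j :: b := by
      cases a with
      | nil => exact absurd (by rw [e]; simpa using hr i (by simp)) hi
      | cons j b => exact ⟨j, b, rfl⟩
    have h1 := cycleRank_swap_mul_of_mem hl hr (j := j) (by simp)
    rw [← e] at h1
    obtain ⟨l, hl1, hl2, hl3⟩ := ih _ (by omega) (swap i j * w) rfl
    refine ⟨swap i j :: l, by simp; omega, ?_, by rw [List.prod_cons, hl3, ← mul_assoc,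
      swap_mul_self, one_mul]⟩
    intro t ht
    rcases List.mem_cons.mp ht with rfl | ht
    · exact ⟨i, j, fun hij => by simp [hij] at hl, rfl⟩
    · exact hl2 t ht

end Equiv.Perm

namespace AbsPerm

open Equiv.Perm

/-- The absolute length of a permutation is the sum of `k - 1` over its cycle lengths `k`. -/
theorem len_eq_cycleRank {n : ℕ} (w : AbsPerm n) :
    len w = cycleRank (show Equiv.Perm (Fin n) from w) := by
  apply le_antisymm
  · obtain ⟨l, h1, h2, h3⟩ := exists_list_length_eq_cycleRank (show Equiv.Perm (Fin n) from w)
    rw [← h1]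
    have := len_le (n := n) l h2
    rwa [show (List.prod (show List (AbsPerm n) from l)) = w from h3] at this
  · obtain ⟨l, h1, h2, h3⟩ := exists_list w
    rw [← h1]
    have := cycleRank_list_prod_le (show List (Equiv.Perm (Fin n)) from l) h2
    rwa [show (List.prod (show List (Equiv.Perm (Fin n)) from l)) = w from h3] at this

end AbsPerm

/-! ### The Möbius function of the absolute order -/

/-- The Möbius number `(-1) ^ (k - 1) * catalan (k - 1)` of the lattice of noncrossing partitions
of a `k`-element set, for `k ≥ 1`. -/
def signedCatalan (k : ℕ) : ℚ := (-1) ^ (k - 1) * (catalan (k - 1) : ℚ)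

theorem signedCatalan_one : signedCatalan 1 = 1 := by simp [signedCatalan]

theorem signedCatalan_succ (k : ℕ) : signedCatalan (k + 1) = (-1) ^ k * (catalan k : ℚ) := rfl

/-- The Catalan recurrence `catalan (p + 1) = ∑ catalan m * catalan (p - m)`, with signs. -/
theorem signedCatalan_add_sum (p : ℕ) :
    signedCatalan (p + 2) +
      ∑ m ∈ Finset.range (p + 1), signedCatalan (m + 1) * signedCatalan (p - m + 1) = 0 := by
  have h : ∀ m ∈ Finset.range (p + 1), signedCatalan (m + 1) * signedCatalan (p - m + 1) =
      (-1) ^ p * ((catalan m : ℚ) * (catalan (p - m) : ℚ)) := by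
    intro m hm
    have hm' : m + (p - m) = p := by have := Finset.mem_range.mp hm; omega
    rw [signedCatalan_succ, signedCatalan_succ]
    conv_rhs => rw [← hm', pow_add]
    rw [hm']
    ring
  rw [Finset.sum_congr rfl h, ← Finset.mul_sum, signedCatalan_succ, catalan_succ, Finset.sum_range]
  push_cast
  ring

namespace Equiv.Perm

variable {α : Type*} [DecidableEq α] [Fintype α]

theorem cycleRank_mul_le (u v : Perm α) : cycleRank (u * v) ≤ cycleRank u + cycleRank v := by
  obtain ⟨l, h1, h2, h3⟩ := exists_list_length_eq_cycleRank u
  obtain ⟨m, k1, k2, k3⟩ := exists_list_length_eq_cycleRank v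
  rw [← h1, ← k1, ← List.length_append]
  conv_lhs => rw [← h3, ← k3, ← List.prod_append]
  refine cycleRank_list_prod_le _ fun t ht => ?_
  rcases List.mem_append.mp ht with h | h
  · exact h2 t h
  · exact k2 t h

/-- `u * v` and `v * u` are conjugate. -/
theorem cycleRank_mul_comm (u v : Perm α) : cycleRank (u * v) = cycleRank (v * u) := by
  have h : v * u = v * (u * v) * v⁻¹ := by group
  rw [h, cycleRank, cycleRank, cycleType_conj]

theorem cycleRank_swap_mul_of_fixed {n i : α} {u : Perm α} (hu : u n = n) (hi : i ≠ n) :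
    cycleRank (swap n i * u) = cycleRank u + 1 := by
  simpa using cycleRank_swap_mul_of_notMem (i := n) (j := i) (a := []) (r := u) (by simp)
    (by simpa using hu) (by simpa using hi)

/-- Multiplying a permutation that moves `n` by the transpositions `(n i)`, with `i` in the cycle
of `n`, cuts this cycle in all possible ways, and the Möbius numbers of the results cancel. -/
theorem sum_cycleWeight_swap_mul_eq_zero {n : α} {x : Perm α} (hx : x n ≠ n) :
    ∑ i with cycleRank (swap n i * x) ≤ cycleRank x,
      cycleWeight signedCatalan (swap n i * x) = 0 := by
  obtain ⟨a, r, hl, hr, rfl⟩ := exists_eq_formPerm_mul x n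
  have hfilter : (Finset.univ.filter fun i =>
      cycleRank (swap n i * ((n :: a).formPerm * r)) ≤ cycleRank ((n :: a).formPerm * r)) =
      (n :: a).toFinset := by
    ext i
    rw [Finset.mem_filter, List.mem_toFinset]
    constructor
    · rintro ⟨-, h⟩
      by_contra hi
      have := cycleRank_swap_mul_of_notMem hl hr hi
      omega
    · intro hi
      refine ⟨Finset.mem_univ _, ?_⟩
      rcases List.mem_cons.mp hi with rfl | hi
      · rw [swap_self, ← one_def, one_mul]
      · have := cycleRank_swap_mul_of_mem hl hr hi
        omega
  obtain ⟨p, hp⟩ : ∃ p, a.length = p + 1 := by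
    refine Nat.exists_eq_succ_of_ne_zero fun h => hx ?_
    rw [List.length_eq_zero_iff] at h
    subst h
    simpa using hr n (by simp)
  have hterm : ∀ (m : ℕ) (hm : m < a.length),
      cycleWeight signedCatalan (swap n a[m] * ((n :: a).formPerm * r)) =
        signedCatalan (m + 1) * signedCatalan (p - m + 1) * cycleWeight signedCatalan r := by
    intro m hm
    have e : n :: a = n :: a.take m ++ a[m] :: a.drop (m + 1) := by
      rw [List.cons_append, ← List.drop_eq_getElem_cons hm, List.take_append_drop]
    have h := cycleWeight_swap_mul_split signedCatalan signedCatalan_one (e ▸ hl) (e ▸ hr)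
    rw [← e] at h
    rw [h, List.length_take, List.length_drop, ← mul_assoc, min_eq_left hm.le]
    congr 4
    omega
  rw [hfilter, List.sum_toFinset _ hl, List.map_cons, List.sum_cons, swap_self, ← one_def, one_mul,
    cycleWeight_formPerm_mul _ signedCatalan_one n a r hl hr, hp]
  have hsum : (a.map fun i =>
      cycleWeight signedCatalan (swap n i * ((n :: a).formPerm * r))).sum =
      ∑ m ∈ Finset.range (p + 1),
        signedCatalan (m + 1) * signedCatalan (p - m + 1) * cycleWeight signedCatalan r := by
    rw [← hp, Finset.sum_range, ← Fin.sum_univ_fun_getElem]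
    exact Finset.sum_congr rfl fun m _ => hterm m m.2
  rw [hsum, ← Finset.sum_mul, ← add_mul, signedCatalan_add_sum, zero_mul]

/-- Every permutation is uniquely `u * swap n i` with `u` fixing `n`. -/
theorem sum_eq_sum_fixed_sum_mul_swap {M : Type*} [AddCommMonoid M] (n : α) (G : Perm α → M) :
    ∑ u, G u = ∑ u with u n = n, ∑ i, G (u * swap n i) := by
  rw [Finset.sum_sigma']
  refine Finset.sum_nbij' (fun u => ⟨u * swap n (u⁻¹ n), u⁻¹ n⟩) (fun p => p.1 * swap n p.2)
    ?_ ?_ ?_ ?_ ?_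
  · intro u _
    simp
  · intro p _
    simp
  · intro u _
    simp [mul_assoc]
  · rintro ⟨u, i⟩ h
    have hu : u n = n := by simpa using h
    have hi : (u * swap n i)⁻¹ n = i := by
      rw [inv_eq_iff_eq, mul_apply, swap_apply_right, hu]
    simp only [hi, mul_assoc, swap_mul_self, mul_one]
  · intro u _
    simp [mul_assoc]

/-- The product of signed Catalan numbers over the cycles is the Möbius function of the absolute
order: its sum over the interval from the identity to `w ≠ 1` vanishes. -/
theorem sum_cycleWeight_interval_eq_zero {w : Perm α} (hw : w ≠ 1) :
    ∑ v with cycleRank v + cycleRank (v⁻¹ * w) = cycleRank w,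
      cycleWeight signedCatalan v = 0 := by
  obtain ⟨n, hn⟩ : ∃ n, w n ≠ n := by
    by_contra! hc
    exact hw (Equiv.ext hc)
  -- The complement `v ↦ w * v⁻¹` maps the interval below `w` onto itself.
  have hcompl : ∑ v with cycleRank v + cycleRank (v⁻¹ * w) = cycleRank w,
      cycleWeight signedCatalan v =
      ∑ u with cycleRank u + cycleRank (u⁻¹ * w) = cycleRank w,
        cycleWeight signedCatalan (u⁻¹ * w) := by
    refine Finset.sum_nbij' (fun v => w * v⁻¹) (fun u => u⁻¹ * w) ?_ ?_ ?_ ?_ ?_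
    · intro v hv
      simp only [Finset.mem_filter, Finset.mem_univ, true_and] at hv ⊢
      rw [cycleRank_mul_comm w, ← hv]
      simp [add_comm]
    · intro u hu
      simp only [Finset.mem_filter, Finset.mem_univ, true_and] at hu ⊢
      rw [cycleRank_mul_comm (u⁻¹ * w)⁻¹ w, ← hu]
      simp [add_comm]
    · intro v _
      simp
    · intro u _
      simp
    · intro v _
      simp
  rw [hcompl, Finset.sum_filter, sum_eq_sum_fixed_sum_mul_swap n]
  refine Finset.sum_eq_zero fun u hu => ?_
  have hu : u n = n := by simpa using hu
  have hu' : u⁻¹ n = n := by rw [inv_eq_iff_eq, hu]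
  set x := u⁻¹ * w with hx
  have hxn : x n ≠ n := by
    intro h
    rw [hx, mul_apply, inv_eq_iff_eq, hu] at h
    exact hn h
  have hwx : u * x = w := by rw [hx, mul_inv_cancel_left]
  have hinv : ∀ i, (u * swap n i)⁻¹ * w = swap n i * x := by
    intro i
    rw [mul_inv_rev, swap_inv, mul_assoc]
  have hrank : ∀ i, cycleRank (u * swap n i) = cycleRank u + if i = n then 0 else 1 := by
    intro i
    split_ifs with h
    · rw [h, swap_self, ← one_def, mul_one, add_zero]
    · rw [← cycleRank_inv, mul_inv_rev, swap_inv, cycleRank_swap_mul_of_fixed hu' h, cycleRank_inv]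
  have hstep : ∀ i, i ≠ n → cycleRank (swap n i * x) + 1 = cycleRank x ∨
      cycleRank (swap n i * x) = cycleRank x + 1 := by
    intro i hi
    obtain ⟨a, r, hl, hr, e⟩ := exists_eq_formPerm_mul x n
    rw [e]
    by_cases h : i ∈ n :: a
    · exact Or.inl (cycleRank_swap_mul_of_mem hl hr (by simpa [hi] using h))
    · exact Or.inr (cycleRank_swap_mul_of_notMem hl hr h)
  have hle := cycleRank_mul_le u x
  rw [hwx] at hle
  -- A join `swap n i * x` would make the total length exceed that of `w = u * x` by two, against
  -- subadditivity of the length, so only the cuts of the cycle of `n` occur.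
  have hcond : ∀ i, cycleRank (u * swap n i) + cycleRank ((u * swap n i)⁻¹ * w) = cycleRank w ↔
      cycleRank u + cycleRank x = cycleRank w ∧ cycleRank (swap n i * x) ≤ cycleRank x := by
    intro i
    rw [hinv, hrank]
    split_ifs with h
    · rw [h, swap_self, ← one_def, one_mul]
      simp
    · have := hstep i h
      omega
  simp_rw [hcond, hinv]
  by_cases hP : cycleRank u + cycleRank x = cycleRank w
  · simp only [hP, true_and]
    rw [← Finset.sum_filter]
    exact sum_cycleWeight_swap_mul_eq_zero hxn
  · simp [hP]

end Equiv.Perm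

/-! ### Chains and the reduced Euler characteristic -/

/-- If `f w = -(1 + ∑_{u < w} f u)` on a finite poset, then `f w` is the signed number of chains
with largest element `w`; hence the signed number of all chains in a lower set is read off
from `f`. -/
theorem sum_chains_subset_lowerSet {P R : Type*} [PartialOrder P] [Fintype P] [DecidableEq P]
    [DecidableRel ((· < ·) : P → P → Prop)]
    [DecidablePred fun F : Finset P => IsChain (· ≤ ·) (F : Set P)] [CommRing R]
    (f : P → R) (hf : ∀ w, f w = -(1 + ∑ u with u < w, f u)) (S : Finset P)
    (hS : IsLowerSet (S : Set P)) :
    ∑ F ∈ S.powerset with IsChain (· ≤ ·) (SetLike.coe F : Set P), (-1 : R) ^ F.card =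
      1 + ∑ w ∈ S, f w := by
  induction h : S.card using Nat.strong_induction_on generalizing S with
  | _ k ih =>
    rcases S.eq_empty_or_nonempty with rfl | hne
    · simp [Finset.filter_singleton]
    obtain ⟨m, hm⟩ := S.exists_maximal hne
    have hmS : m ∈ S := hm.prop
    have hlow : IsLowerSet ((S.erase m : Finset P) : Set P) := by
      intro a b hba ha
      simp only [Finset.coe_erase, Set.mem_sdiff, Finset.mem_coe, Set.mem_singleton_iff] at ha ⊢
      refine ⟨hS hba ha.1, ?_⟩
      rintro rfl
      exact ha.2 (le_antisymm (hm.le_of_ge ha.1 hba) hba)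
    have hlow2 : IsLowerSet ((Finset.univ.filter (· < m) : Finset P) : Set P) := by
      intro a b hba ha
      simp only [Finset.coe_filter, Finset.mem_univ, true_and, Set.mem_ofPred_eq] at ha ⊢
      exact hba.trans_lt ha
    have hsub : Finset.univ.filter (· < m) ⊆ S.erase m := by
      intro u hu
      have hu : u < m := by simpa using hu
      exact Finset.mem_erase.mpr ⟨hu.ne, hS hu.le hmS⟩
    have hcard : (S.erase m).card < k := h ▸ Finset.card_erase_lt_of_mem hmS
    have h1 := ih _ hcard _ hlow rfl
    have h2 := ih _ ((Finset.card_le_card hsub).trans_lt hcard) _ hlow2 rfl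
    have hSm : insert m (S.erase m) = S := Finset.insert_erase hmS
    have hchain : ∀ F ∈ (S.erase m).powerset, IsChain (· ≤ ·) ((insert m F : Finset P) : Set P) ↔
        (F ⊆ Finset.univ.filter (· < m) ∧ IsChain (· ≤ ·) (F : Set P)) := by
      intro F hF
      rw [Finset.mem_powerset] at hF
      rw [Finset.coe_insert]
      constructor
      · intro hc
        refine ⟨fun u hu => ?_, hc.mono (Set.subset_insert _ _)⟩
        have huS := Finset.mem_erase.mp (hF hu)
        rcases hc (Set.mem_insert_of_mem m (Finset.mem_coe.mpr hu)) (Set.mem_insert m _) huS.1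
          with hle | hle
        · simpa using lt_of_le_of_ne hle huS.1
        · exact absurd (le_antisymm (hm.le_of_ge huS.2 hle) hle) huS.1
      · rintro ⟨hlt, hc⟩
        exact hc.insert fun u hu _ => Or.inr (by simpa using (Finset.mem_filter.mp (hlt hu)).2.le)
    have hins : ∑ F ∈ (S.erase m).powerset,
        (if IsChain (· ≤ ·) ((insert m F : Finset P) : Set P) then
          (-1 : R) ^ (insert m F).card else 0) =
        - ∑ F ∈ (Finset.univ.filter (· < m)).powerset with IsChain (· ≤ ·) (SetLike.coe F : Set P),
          (-1 : R) ^ F.card := by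
      rw [← Finset.sum_filter, ← Finset.sum_neg_distrib]
      refine Finset.sum_congr ?_ ?_
      · ext F
        simp only [Finset.mem_filter, Finset.mem_powerset]
        constructor
        · rintro ⟨hF, hc⟩
          exact (hchain F (Finset.mem_powerset.mpr hF)).mp hc
        · rintro ⟨hF, hc⟩
          have hF' := hF.trans hsub
          exact ⟨hF', (hchain F (Finset.mem_powerset.mpr hF')).mpr ⟨hF, hc⟩⟩
      · intro F hF
        have hF' := (Finset.mem_powerset.mp (Finset.mem_filter.mp hF).1).trans hsub
        rw [Finset.card_insert_of_notMem fun hmF => Finset.notMem_erase m S (hF' hmF), pow_succ]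
        ring
    rw [← hSm, Finset.sum_filter, Finset.sum_powerset_insert (Finset.notMem_erase m S),
      ← Finset.sum_filter, h1, hins, h2, ← hf, Finset.sum_insert (Finset.notMem_erase m S)]
    ring

theorem mem_faces_orderComplex {P : Type*} [PartialOrder P] (F : Finset P) :
    F ∈ (orderComplex P).faces ↔ F.Nonempty ∧ IsChain (· ≤ ·) (F : Set P) :=
  Iff.rfl

open Classical in
/-- The faces of the order complex, with the empty face, are the chains of the whole poset. -/
theorem reducedEulerChar_orderComplex {P R : Type*} [PartialOrder P] [Fintype P]
    [CommRing R] (f : P → R) (hf : ∀ w, f w = -(1 + ∑ u with u < w, f u)) :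
    (reducedEulerChar (orderComplex P) : R) = -(1 + ∑ w, f w) := by
  have h := sum_chains_subset_lowerSet f hf Finset.univ (by simpa using isLowerSet_univ)
  rw [← h, reducedEulerChar]
  have he : (Finset.univ.powerset.filter fun F : Finset P => IsChain (· ≤ ·) (F : Set P)) =
      insert ∅ (Finset.univ.filter fun F => F ∈ (orderComplex P).faces) := by
    ext F
    simp only [Finset.mem_filter, Finset.mem_powerset, Finset.subset_univ, true_and,
      Finset.mem_insert, Finset.mem_univ, mem_faces_orderComplex]
    rcases F.eq_empty_or_nonempty with rfl | hF
    · simp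
    · simp [hF, hF.ne_empty]
  rw [he, Finset.sum_insert (by simp [mem_faces_orderComplex])]
  push_cast
  simp only [pow_succ, Finset.card_empty, pow_zero, mul_neg, mul_one, Finset.sum_neg_distrib]
  ring

namespace AbsPerm

open Equiv.Perm

/-- The Möbius function of the absolute order, from the identity to `w`, defined by its closed form
as the product of the signed Catalan numbers of the cycle lengths. -/
noncomputable def moebius {n : ℕ} (w : AbsPerm n) : ℚ :=
  cycleWeight signedCatalan (show Equiv.Perm (Fin n) from w)

theorem moebius_one (n : ℕ) : moebius (1 : AbsPerm n) = 1 := by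
  have : cycleWeight signedCatalan (1 : Equiv.Perm (Fin n)) = 1 := by simp [cycleWeight]
  exact this

open Classical in
theorem sum_moebius_le {n : ℕ} {w : AbsPerm n} (hw : w ≠ 1) : ∑ v with v ≤ w, moebius v = 0 := by
  have h := sum_cycleWeight_interval_eq_zero (w := show Equiv.Perm (Fin n) from w) hw
  rw [← h]
  refine Finset.sum_congr ?_ fun _ _ => rfl
  refine Finset.filter_congr fun v _ => ?_
  change len v + len (v⁻¹ * w) = len w ↔ _
  rw [len_eq_cycleRank, len_eq_cycleRank, len_eq_cycleRank]
  rfl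

theorem one_le {n : ℕ} (w : AbsPerm n) : 1 ≤ w := by
  change len 1 + len (1⁻¹ * w) = len w
  rw [len_one, inv_one, one_mul, zero_add]

theorem reducedEulerChar_properPart (n : ℕ) :
    (reducedEulerChar (orderComplex (ProperPart n)) : ℚ) = -∑ w : AbsPerm n, moebius w := by
  classical
  have hsplit : ∀ s : Finset (AbsPerm n), (1 : AbsPerm n) ∈ s →
      ∑ v ∈ s, moebius v = 1 + ∑ v : ProperPart n with v.1 ∈ s, moebius v.1 := by
    intro s hs
    rw [← Finset.add_sum_erase _ _ hs, moebius_one]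
    congr 1
    symm
    refine Finset.sum_bij (fun v _ => v.1) ?_ ?_ ?_ ?_
    · intro v hv
      exact Finset.mem_erase.mpr ⟨v.2, (Finset.mem_filter.mp hv).2⟩
    · intro a _ b _ h
      exact Subtype.ext h
    · intro b hb
      obtain ⟨h1, h2⟩ := Finset.mem_erase.mp hb
      exact ⟨⟨b, h1⟩, by simpa using h2, rfl⟩
    · intro _ _
      rfl
  rw [reducedEulerChar_orderComplex (fun w : ProperPart n => moebius w.1),
    hsplit _ (Finset.mem_univ 1)]
  · simp
  · intro w
    have h0 := sum_moebius_le w.2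
    rw [hsplit _ (by simpa using one_le w.1)] at h0
    have hins : (Finset.univ.filter fun v : ProperPart n =>
        v.1 ∈ Finset.univ.filter fun u => u ≤ w.1) =
        insert w (Finset.univ.filter fun v => v < w) := by
      ext v
      simp only [Finset.mem_filter, Finset.mem_univ, true_and, Finset.mem_insert]
      rw [Subtype.coe_le_coe, le_iff_eq_or_lt]
    rw [hins, Finset.sum_insert (by simp)] at h0
    linear_combination h0

end AbsPerm

/-! ### The exponential formula for weighted permutations -/

namespace Equiv.Perm

variable {α : Type*} [DecidableEq α] [Fintype α]

/-- The product of the cycle weights of `w`, where the cycle through the marked point `x` is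
weighted by `φ` and all other cycles by `ψ`. A fixed point `x` counts as a cycle of length one;
`max 1` corrects the empty support of `w.cycleOf x` in that case. -/
def markedWeight {M : Type*} [CommMonoid M] (φ ψ : ℕ → M) (w : Perm α) (x : α) : M :=
  φ (max 1 (w.cycleOf x).support.card) * cycleWeight ψ ((w.cycleOf x)⁻¹ * w)

theorem markedWeight_formPerm_mul {M : Type*} [CommMonoid M] (φ ψ : ℕ → M) (x : α) (a : List α)
    (r : Perm α) (hl : (x :: a).Nodup) (hr : ∀ y ∈ x :: a, r y = y) :
    markedWeight φ ψ ((x :: a).formPerm * r) x = φ (a.length + 1) * cycleWeight ψ r := by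
  have hx : r x = x := hr x List.mem_cons_self
  have hc : ((x :: a).formPerm * r).cycleOf x = (x :: a).formPerm := by
    rw [cycleOf_mul_of_apply_right_eq_self (disjoint_formPerm _ r hr).commute x hx]
    cases a with
    | nil => exact cycleOf_one x
    | cons y a =>
      refine (List.isCycle_formPerm hl (by simp)).cycleOf_eq ?_
      rw [Ne, List.formPerm_apply_mem_eq_self_iff _ hl x List.mem_cons_self]
      simp
  rw [markedWeight, hc, inv_mul_cancel_left]
  cases a with
  | nil => simp
  | cons y a =>
    rw [List.support_formPerm_of_nodup _ hl (by simp), List.toFinset_card_of_nodup hl]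
    simp

theorem markedWeight_self {M : Type*} [CommMonoid M] (φ : ℕ → M) (h1 : φ 1 = 1) (w : Perm α)
    (x : α) : markedWeight φ φ w x = cycleWeight φ w := by
  obtain ⟨a, r, hl, hr, rfl⟩ := exists_eq_formPerm_mul w x
  rw [markedWeight_formPerm_mul φ φ x a r hl hr, cycleWeight_formPerm_mul φ h1 x a r hl hr]

theorem markedWeight_of_fixed {M : Type*} [CommMonoid M] (φ ψ : ℕ → M) {w : Perm α} {x : α}
    (hx : w x = x) : markedWeight φ ψ w x = φ 1 * cycleWeight ψ w := by
  simpa using markedWeight_formPerm_mul φ ψ x [] w (by simp) (by simpa using hx)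

/-- Inserting the fixed point `x` into the cycle of `i` lengthens that cycle by one. -/
theorem markedWeight_swap_mul {M : Type*} [CommMonoid M] (φ ψ : ℕ → M) {u : Perm α} {x i : α}
    (hx : u x = x) (hi : i ≠ x) :
    markedWeight φ ψ (swap x i * u) x = markedWeight (fun k => φ (k + 1)) ψ u i := by
  obtain ⟨a, r, hl, hr, rfl⟩ := exists_eq_formPerm_mul u i
  have hxa : x ∉ i :: a := by
    intro h
    rw [formPerm_mul_apply_of_mem _ _ hr h, List.formPerm_apply_mem_eq_self_iff _ hl x h] at hx
    have : a = [] := by simpa using hx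
    subst this
    simp only [List.mem_singleton] at h
    exact hi h.symm
  have hrx : r x = x := by rwa [formPerm_mul_apply_of_notMem _ _ hr hxa] at hx
  rw [markedWeight_formPerm_mul _ _ i a r hl hr, ← mul_assoc, ← List.formPerm_cons_cons,
    markedWeight_formPerm_mul φ ψ x (i :: a) r (List.nodup_cons.mpr ⟨hxa, hl⟩)]
  · simp
  · intro y hy
    rcases List.mem_cons.mp hy with rfl | hy
    · exact hrx
    · exact hr y hy

/-- A permutation supported on `S` either fixes `x ∈ S` or is uniquely `swap x i * u` with
`i ∈ S`, `i ≠ x`, and `u` supported on `S.erase x`. -/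
theorem sum_support_subset {M : Type*} [AddCommMonoid M] {S : Finset α} {x : α} (hx : x ∈ S)
    (G : Perm α → M) :
    ∑ w with w.support ⊆ S, G w =
      ∑ u with u.support ⊆ S.erase x, (G u + ∑ i ∈ S.erase x, G (swap x i * u)) := by
  have hfix : ∀ {u : Perm α}, u.support ⊆ S.erase x → u x = x := by
    intro u hu
    by_contra h
    exact Finset.notMem_erase x S (hu (mem_support.mpr h))
  have hins : ∀ u : Perm α, G u + ∑ i ∈ S.erase x, G (swap x i * u) =
      ∑ i ∈ S, G (swap x i * u) := by
    intro u
    rw [← Finset.add_sum_erase S _ hx, swap_self, ← one_def, one_mul]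
  simp_rw [hins]
  rw [Finset.sum_sigma']
  refine Finset.sum_nbij' (fun w => ⟨swap x (w x) * w, w x⟩) (fun p => swap x p.2 * p.1)
    ?_ ?_ ?_ ?_ ?_
  · intro w hw
    have hw : w.support ⊆ S := by simpa using hw
    have hwx : w x ∈ S := by
      by_cases h : w x = x
      · rwa [h]
      · exact hw (apply_mem_support.mpr (mem_support.mpr h))
    simp only [Finset.mem_sigma, Finset.mem_filter, Finset.mem_univ, true_and]
    refine ⟨fun y hy => ?_, hwx⟩
    rw [mem_support, mul_apply] at hy
    refine Finset.mem_erase.mpr ⟨?_, ?_⟩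
    · rintro rfl
      simp at hy
    · by_contra hyS
      have hwy : w y = y := by
        by_contra h
        exact hyS (hw (mem_support.mpr h))
      rw [hwy, swap_apply_of_ne_of_ne (ne_of_mem_of_not_mem hx hyS).symm
        (ne_of_mem_of_not_mem hwx hyS).symm] at hy
      exact hy rfl
  · rintro ⟨u, i⟩ h
    simp only [Finset.mem_sigma, Finset.mem_filter, Finset.mem_univ, true_and] at h ⊢
    intro y hy
    by_contra hyS
    have huy : u y = y := by
      by_contra h'
      exact hyS (Finset.mem_of_mem_erase (h.1 (mem_support.mpr h')))
    rw [mem_support, mul_apply, huy,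
      swap_apply_of_ne_of_ne (ne_of_mem_of_not_mem hx hyS).symm
        (ne_of_mem_of_not_mem h.2 hyS).symm] at hy
    exact hy rfl
  · intro w _
    simp [← mul_assoc]
  · rintro ⟨u, i⟩ h
    simp only [Finset.mem_sigma, Finset.mem_filter, Finset.mem_univ, true_and] at h
    have hux := hfix h.1
    have : (swap x i * u) x = i := by rw [mul_apply, hux, swap_apply_left]
    simp only [this, ← mul_assoc, swap_mul_self, one_mul]
  · intro w _
    simp [← mul_assoc]

/-- The exponential formula for weighted permutations: if `E' = (∑ φ (k + 1) t ^ k) E` and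
`E 0 = 1`, then `E` is the exponential generating function of the total cycle weights.
The second clause is the refinement in which the cycle through a marked point has its own weight. -/
theorem sum_cycleWeight_and_sum_markedWeight (φ : ℕ → ℚ) (h1 : φ 1 = 1) (E : ℕ → ℚ)
    (h0 : E 0 = 1)
    (hE : ∀ n : ℕ, (n + 1 : ℚ) * E (n + 1) = ∑ k ∈ Finset.range (n + 1), φ (k + 1) * E (n - k))
    (N : ℕ) :
    (∀ S : Finset α, S.card = N →
      ∑ w with w.support ⊆ S, cycleWeight φ w = N.factorial * E N) ∧
    (∀ (S : Finset α) (x : α), x ∈ S → S.card = N + 1 → ∀ θ : ℕ → ℚ,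
      ∑ w with w.support ⊆ S, markedWeight θ φ w x =
        N.factorial * ∑ k ∈ Finset.range (N + 1), θ (k + 1) * E (N - k)) := by
  have hstep : ∀ (S : Finset α) (x : α), x ∈ S → ∀ θ : ℕ → ℚ,
      ∑ w with w.support ⊆ S, markedWeight θ φ w x =
        θ 1 * ∑ u with u.support ⊆ S.erase x, cycleWeight φ u +
          ∑ i ∈ S.erase x, ∑ u with u.support ⊆ S.erase x,
            markedWeight (fun k => θ (k + 1)) φ u i := by
    intro S x hx θ
    rw [sum_support_subset hx, Finset.sum_add_distrib, Finset.sum_comm (s := S.erase x),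
      Finset.mul_sum]
    have hfix : ∀ {u : Perm α}, u ∈ Finset.univ.filter (fun u : Perm α => u.support ⊆ S.erase x) →
        u x = x := by
      intro u hu
      by_contra h
      exact Finset.notMem_erase x S ((Finset.mem_filter.mp hu).2 (mem_support.mpr h))
    congr 1
    · exact Finset.sum_congr rfl fun u hu => markedWeight_of_fixed θ φ (hfix hu)
    · exact Finset.sum_congr rfl fun u hu => Finset.sum_congr rfl fun i hi =>
        markedWeight_swap_mul θ φ (hfix hu) (Finset.ne_of_mem_erase hi)
  induction N with
  | zero =>
    have hA : ∀ S : Finset α, S.card = 0 →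
        ∑ w with w.support ⊆ S, cycleWeight φ w = (Nat.factorial 0 : ℕ) * E 0 := by
      intro S hS
      rw [Finset.card_eq_zero] at hS
      subst hS
      have : (Finset.univ.filter fun w : Perm α => w.support ⊆ ∅) = {1} := by
        ext w
        simp [Finset.subset_empty]
      rw [this]
      simp [cycleWeight, h0]
    refine ⟨hA, fun S x hx hS θ => ?_⟩
    have he : S.erase x = ∅ := by
      rw [← Finset.card_eq_zero, Finset.card_erase_of_mem hx, hS]
    rw [hstep S x hx, he, hA ∅ rfl]
    simp
  | succ N ih =>
    have hA : ∀ S : Finset α, S.card = N + 1 →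
        ∑ w with w.support ⊆ S, cycleWeight φ w = ((N + 1).factorial : ℕ) * E (N + 1) := by
      intro S hS
      obtain ⟨x, hx⟩ : S.Nonempty := Finset.card_pos.mp (by omega)
      have h := ih.2 S x hx hS φ
      simp_rw [markedWeight_self φ h1] at h
      rw [h, ← hE, Nat.factorial_succ]
      push_cast
      ring
    refine ⟨hA, fun S x hx hS θ => ?_⟩
    have hc : (S.erase x).card = N + 1 := by rw [Finset.card_erase_of_mem hx, hS]; rfl
    rw [hstep S x hx, hA _ hc, Finset.sum_congr rfl fun i hi => ih.2 (S.erase x) i hi hc _,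
      Finset.sum_const, hc, Finset.sum_range_succ' _ (N + 1), Nat.factorial_succ]
    simp only [Nat.add_sub_add_right, nsmul_eq_mul, Nat.sub_zero]
    push_cast
    ring

end Equiv.Perm

/-! ### The Catalan generating function and the exponential generating function -/

/-- The functional equation `C = 1 + t C ^ 2`. -/
theorem catalanGF_eq : catalanGF = 1 + X * catalanGF ^ 2 := by
  have h := congrArg (PowerSeries.map (Nat.castRingHom ℚ)) catalanSeries_sq_mul_X_add_one
  have hc : PowerSeries.map (Nat.castRingHom ℚ) catalanSeries = catalanGF := by
    ext n
    simp [catalanGF]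
  simp only [map_add, map_mul, map_pow, map_one, PowerSeries.map_X, hc] at h
  linear_combination -h

theorem constantCoeff_catalanGF : constantCoeff catalanGF = 1 := by
  rw [← coeff_zero_eq_constantCoeff_apply, catalanGF, coeff_mk]
  simp

theorem two_X_mul_catalanGF : 2 * X * catalanGF = 1 - sqrtOneSubFour := by
  have h : (1 - 2 * X * catalanGF - sqrtOneSubFour) *
      (1 - 2 * X * catalanGF + sqrtOneSubFour) = 0 := by
    linear_combination -sqrtOneSubFour_sq - 4 * X * catalanGF_eq
  rcases mul_eq_zero.mp h with h | h
  · linear_combination -h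
  · -- The other root `-√(1 - 4t)` has the wrong constant term.
    exfalso
    have h' := congrArg constantCoeff h
    have hs : constantCoeff sqrtOneSubFour = 1 := by
      rw [← coeff_zero_eq_constantCoeff_apply, sqrtOneSubFour, coeff_rescale]
      simp
    simp [hs] at h'

/-- The series `C(t) exp(-2tC(t))`. -/
noncomputable def catalanExp : ℚ⟦X⟧ :=
  catalanGF * (PowerSeries.exp ℚ).subst (-2 * X * catalanGF)

theorem constantCoeff_neg_two_X_mul_catalanGF :
    constantCoeff (-2 * X * catalanGF) = 0 := by
  simp

theorem hasSubst_neg_two_X_mul_catalanGF : HasSubst (-2 * X * catalanGF) :=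
  HasSubst.of_constantCoeff_zero' constantCoeff_neg_two_X_mul_catalanGF

theorem constantCoeff_catalanExp : constantCoeff catalanExp = 1 := by
  rw [catalanExp, map_mul, constantCoeff_catalanGF, one_mul]
  have h : PowerSeries.exp ℚ = 1 + (PowerSeries.exp ℚ - 1) := by ring
  have h0 : constantCoeff ((PowerSeries.exp ℚ - 1).subst (-2 * X * catalanGF)) = 0 :=
    constantCoeff_subst_eq_zero constantCoeff_neg_two_X_mul_catalanGF _ (by simp)
  rw [h, subst_add hasSubst_neg_two_X_mul_catalanGF, map_add, h0,
    ← coe_substAlgHom hasSubst_neg_two_X_mul_catalanGF, map_one]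
  simp

/-- Differentiating `C = 1 + t C ^ 2` gives `(1 - 2tC) C' = C ^ 2`, whence this equation. -/
theorem derivative_catalanExp : d⁄dX ℚ catalanExp = -(catalanGF * catalanExp) := by
  have hC := congrArg (d⁄dX ℚ) catalanGF_eq
  have h2 : d⁄dX ℚ (-2 : ℚ⟦X⟧) = 0 := by
    rw [show (-2 : ℚ⟦X⟧) = PowerSeries.C (-2 : ℚ) by rw [map_neg, map_ofNat], derivative_C]
  simp only [map_add, Derivation.leibniz, Derivation.leibniz_pow, Derivation.map_one_eq_zero,
    derivative_X, smul_eq_mul, nsmul_eq_mul] at hC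
  rw [catalanExp, Derivation.leibniz, derivative_subst hasSubst_neg_two_X_mul_catalanGF,
    derivative_exp]
  simp only [Derivation.leibniz, derivative_X, h2, smul_eq_mul]
  push_cast at hC
  linear_combination ((PowerSeries.exp ℚ).subst (-2 * X * catalanGF)) * hC

theorem coeff_succ_catalanExp (n : ℕ) :
    coeff (n + 1) catalanExp * (n + 1) =
      -∑ k ∈ Finset.range (n + 1), (catalan k : ℚ) * coeff (n - k) catalanExp := by
  rw [← coeff_derivative, derivative_catalanExp, map_neg, coeff_mul,
    Finset.Nat.sum_antidiagonal_eq_sum_range_succ_mk]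
  simp [catalanGF]

theorem AbsPerm.sum_moebius (n : ℕ) :
    ∑ w : AbsPerm n, AbsPerm.moebius w = n.factorial * ((-1) ^ n * coeff n catalanExp) := by
  have h := (Equiv.Perm.sum_cycleWeight_and_sum_markedWeight (α := Fin n) signedCatalan
    signedCatalan_one (fun n => (-1) ^ n * coeff n catalanExp)
    (by simp [constantCoeff_catalanExp]) ?_ n).1 Finset.univ (by simp)
  · rw [← h]
    simp only [Finset.subset_univ, Finset.filter_true]
    rfl
  · intro n
    have h := coeff_succ_catalanExp n
    have hs : ∑ k ∈ Finset.range (n + 1),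
        signedCatalan (k + 1) * ((-1) ^ (n - k) * coeff (n - k) catalanExp) =
        (-1) ^ n * ∑ k ∈ Finset.range (n + 1), (catalan k : ℚ) * coeff (n - k) catalanExp := by
      rw [Finset.mul_sum]
      refine Finset.sum_congr rfl fun k hk => ?_
      have hk' : k + (n - k) = n := by have := Finset.mem_range.mp hk; omega
      conv_rhs => rw [← hk', pow_add]
      rw [hk', signedCatalan_succ]
      ring
    rw [hs, pow_succ]
    linear_combination -(-1) ^ n * h


/-- The exponential generating function of `(-1) ^ n` times the reduced Euler characteristic of the
order complex of the proper part of the absolute order on the symmetric group `S_n`, `n ≥ 1`,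
as an identity of formal power series. The second clause is the closed form
`C(t) = (1 - √(1 - 4t)) / (2t)` of the Catalan generating function. -/
theorem theorem1p2 :
    (PowerSeries.mk fun n : ℕ =>
        if n = 0 then (0 : ℚ)
        else (-1) ^ n * (reducedEulerChar (orderComplex (AbsPerm.ProperPart n)) : ℚ) /
          (n.factorial : ℚ)) =
      1 - catalanGF * (PowerSeries.exp ℚ).subst (-2 * PowerSeries.X * catalanGF) ∧
    2 * PowerSeries.X * catalanGF = 1 - sqrtOneSubFour := by
  refine ⟨?_, two_X_mul_catalanGF⟩
  change _ = 1 - catalanExp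
  ext n
  rw [coeff_mk, map_sub, coeff_one]
  split_ifs with hn
  · subst hn
    simp [constantCoeff_catalanExp]
  · have hfac : (n.factorial : ℚ) ≠ 0 := Nat.cast_ne_zero.mpr n.factorial_ne_zero
    have hsq : ((-1 : ℚ) ^ n) * (-1) ^ n = 1 := by rw [← mul_pow]; simp
    rw [AbsPerm.reducedEulerChar_properPart, AbsPerm.sum_moebius, div_eq_iff hfac]
    linear_combination -(n.factorial : ℚ) * coeff n catalanExp * hsq
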